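/- **Setting.** Let $R$ be a commutative ring with identity and let $W\subseteq R$ be a multiplicatively closed set containing $1$. A *class* $\mathcal M$ of $R$-modules means an isomorphism-invariant class closed under submodules and quotient modules. A *submodule selector* $\alpha$ on an isomorphism-invariant class $\mathcal M$ assigns to each $M\in\mathcal M$ a submodule $\alpha(M)\subseteq M$ with $\varphi(\alpha(M))=\alpha(N)$ for every isomorphism $\varphi:M\to N$ in $\mathcal M$. We write $\alpha\le\beta$ if $\alpha(M)\subseteq\beta(M)$ for all $M\in\mathcal M$. Further, $\alpha$ is *idempotent* if $\alpha(\alpha(M))=\alpha(M)$ for all $M$, *co-idempotent* if $\alpha(M/\alpha(M))=0$ for all $M$, and *functorial* if $g(\alpha(M))\subseteq\alpha(N)$ for every $R$-linear map $g:M\to N$ in $\mathcal M$. For a directed system $(s_j)_j$ of submodule selectors, meaning that $s_i\le s_j$ for $i\le j$ in a directed index set, $(\varinjlim_j s_j)(M):=\bigcup_j s_j(M)$. For $R$-modules $L,M$ put $\operatorname{tr}_L(M):=\sum_{f\in\operatorname{Hom}_R(L,M)}f(L)$. An $R$-module $M$ is *$W$-torsion free* (resp. *$W$-divisible*) if multiplication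 by each $w\in W$ on $M$ is injective (resp. surjective), and *$h_W$-divisible* if there is a surjective $R$-linear map onto $M$ from a free $W^{-1}R$-module. Let $\operatorname{tor}_W(M):=\ker(M\to W^{-1}M)$, and let $\operatorname{dv}_W(M)$ be the sum of all $W$-divisible submodules of $M$. Then $\operatorname{tr}_L$, $\operatorname{tor}_W$ and $\operatorname{dv}_W$ are submodule selectors. If $R$ is a complete Noetherian local ring with residue field $k$, let $E$ be an injective hull of $k$ and $M^\vee:=\operatorname{Hom}_R(M,E)$. A module $M$ is *Matlis-dualizable* if $M^{\vee\vee}\cong M$. For a class $\mathcal M$ of Matlis-dualizable modules, $\mathcal M^\vee$ denotes the class of all modules isomorphic to $N^\vee$ for some $N\in\mathcal M$. The *smile dual* of a submodule selector $\alpha$ on $\mathcal M$ is the submodule selector $\alpha^\smallsmile$ on $\mathcal M^\vee$ given by $\alpha^\smallsmile(M):=(M^\vee/\alpha(M^\vee))^\vee$, regarded as a submodule of $M$ via the evaluation map $M\to M^{\vee\vee}$. **Proposition 9.3.** 1. An $R$-module $M$ is $W$-torsion free if and only if $\operatorname{tor}_W(M)=0$. 2. An $R$-module $M$ is $W$-divisible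 if and only if $\operatorname{dv}_W(M)=M$. 3. An $R$-module $M$ is $h_W$-divisible if and only if $\operatorname{tr}_{W^{-1}R}(M)=M$. 4. For every $R$-module $M$, $\operatorname{tr}_{W^{-1}R}(M)\subseteq\operatorname{dv}_W(M)$; that is, $\operatorname{tr}_{W^{-1}R}\le\operatorname{dv}_W$ on every class of modules. 5. On every class of modules, the selectors $\operatorname{tr}_{R/(w)}$, $w\in W$, form a directed system, where $W$ is directed by divisibility in $R$, and $\operatorname{tor}_W=\varinjlim_{w\in W}\operatorname{tr}_{R/(w)}$. 6. On every class of modules, $\operatorname{dv}_W$ is idempotent and functorial. 7. On every class of modules, $\operatorname{tor}_W$ is idempotent, functorial and co-idempotent. If moreover $R$ is a complete Noetherian local ring, then: 8. $\operatorname{dv}_W(M)=\operatorname{tr}_{W^{-1}R}(M)$ for every Matlis-dualizable $R$-module $M$. 9. For every class $\mathcal M$ of Matlis-dualizable modules, the smile dual of $\operatorname{dv}_W$ on $\mathcal M$ is $\operatorname{tor}_W$ on $\mathcal M^\vee$. Also $\operatorname{tor}_W(M)=(M^\vee/\operatorname{dv}_W(M^\vee))^\vee$, regarded as a submodule of $M$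 via the evaluation map, for every Matlis-dualizable $M$. 10. $\operatorname{dv}_W(M)=\bigcap_{w\in W}wM$ for every Matlis-dualizable $R$-module $M$. -/

import Mathlib

universe u

noncomputable section

namespace Selectors

/-! ### Classes of modules and submodule selectors -/

/-- A class of `R`-modules (living in the universe of `R`). -/
abbrev ModuleClass (R : Type u) [CommRing R] :=
  ∀ (M : Type u) [AddCommGroup M] [Module R M], Prop

/-- The class is closed under taking submodules and quotient modules; classes of modules are
understood to be invariant under isomorphism. -/
structure ModuleClass.IsClosed {R : Type u} [CommRing R] (P : ModuleClass R) : Prop where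
  submodule : ∀ {M : Type u} [AddCommGroup M] [Module R M] (L : Submodule R M), P M → P L
  quotient : ∀ {M : Type u} [AddCommGroup M] [Module R M] (L : Submodule R M), P M → P (M ⧸ L)
  equiv : ∀ {M N : Type u} [AddCommGroup M] [Module R M] [AddCommGroup N] [Module R N],
    (M ≃ₗ[R] N) → P M → P N

/-- A submodule selector on the class `P`: a choice of a submodule `α(M) ⊆ M` for each `M` in `P`,
compatible with isomorphisms. -/
@[ext]
structure SubmoduleSelector {R : Type u} [CommRing R] (P : ModuleClass R) where
  sel : ∀ (M : Type u) [AddCommGroup M] [Module R M], P M → Submodule R M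
  map_equiv : ∀ {M N : Type u} [AddCommGroup M] [Module R M] [AddCommGroup N] [Module R N]
    (hM : P M) (hN : P N) (e : M ≃ₗ[R] N), (sel M hM).map (e : M →ₗ[R] N) = sel N hN

namespace SubmoduleSelector

variable {R : Type u} [CommRing R] {P : ModuleClass R}

/-- `α ≤ β` if `α(M) ⊆ β(M)` for all `M` in the class. -/
instance : PartialOrder (SubmoduleSelector P) where
  le α β := ∀ (M : Type u) [AddCommGroup M] [Module R M] (hM : P M), α.sel M hM ≤ β.sel M hM
  le_refl α M _ _ hM := le_rfl
  le_trans α β γ h₁ h₂ M _ _ hM := (h₁ M hM).trans (h₂ M hM)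
  le_antisymm α β h₁ h₂ := by
    ext M _ _ hM x
    exact ⟨fun h => h₁ M hM h, fun h => h₂ M hM h⟩

/-- `g(α(M)) ⊆ α(N)` for every `R`-linear map `g : M → N` between modules of the class. -/
def IsFunctorial (α : SubmoduleSelector P) : Prop :=
  ∀ {M N : Type u} [AddCommGroup M] [Module R M] [AddCommGroup N] [Module R N]
    (hM : P M) (hN : P N) (g : M →ₗ[R] N), (α.sel M hM).map g ≤ α.sel N hN

/-- `α(α(M)) = α(M)`, as submodules of `M`. -/
def IsIdempotent (hP : P.IsClosed) (α : SubmoduleSelector P) : Prop :=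
  ∀ (M : Type u) [AddCommGroup M] [Module R M] (hM : P M),
    (α.sel (α.sel M hM) (hP.submodule _ hM)).map (α.sel M hM).subtype = α.sel M hM

/-- `α(M / α(M)) = 0`. -/
def IsCoidempotent (hP : P.IsClosed) (α : SubmoduleSelector P) : Prop :=
  ∀ (M : Type u) [AddCommGroup M] [Module R M] (hM : P M),
    α.sel (M ⧸ α.sel M hM) (hP.quotient _ hM) = ⊥

/-- The direct limit of a directed system of submodule selectors: `M ↦ ⋃ j, s j (M)`. -/
def dirLim {Γ : Type u} [Preorder Γ] [IsDirected Γ (· ≤ ·)] [Nonempty Γ]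
    (s : Γ → SubmoduleSelector P) (hs : Monotone s) : SubmoduleSelector P where
  sel M _ _ hM :=
    { carrier := ⋃ j, ((s j).sel M hM : Set M)
      zero_mem' := Set.mem_iUnion.2 ⟨Classical.arbitrary Γ, zero_mem _⟩
      add_mem' := by
        intro a b ha hb
        obtain ⟨i, hi⟩ := Set.mem_iUnion.1 ha
        obtain ⟨j, hj⟩ := Set.mem_iUnion.1 hb
        obtain ⟨k, hik, hjk⟩ := exists_ge_ge i j
        exact Set.mem_iUnion.2 ⟨k, add_mem (hs hik M hM hi) (hs hjk M hM hj)⟩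
      smul_mem' := by
        intro c a ha
        obtain ⟨i, hi⟩ := Set.mem_iUnion.1 ha
        exact Set.mem_iUnion.2 ⟨i, Submodule.smul_mem _ c hi⟩ }
  map_equiv := by
    intro M N _ _ _ _ hM hN e
    apply SetLike.coe_injective
    rw [Submodule.map_coe]
    change (⇑(e : M →ₗ[R] N)) '' (⋃ j, ((s j).sel M hM : Set M)) = ⋃ j, ((s j).sel N hN : Set N)
    rw [Set.image_iUnion]
    refine Set.iUnion_congr fun j => ?_
    rw [← (s j).map_equiv hM hN e, Submodule.map_coe]

end SubmoduleSelector

/-! ### Traces, torsion and divisibility -/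

section Rules

variable (R : Type u) [CommRing R] (W : Submonoid R)

/-- The `L`-trace of `M`: the sum of the images `f(L)` over all `R`-linear maps `f : L → M`. -/
def trace (L M : Type u) [AddCommGroup L] [Module R L] [AddCommGroup M] [Module R M] :
    Submodule R M :=
  ⨆ f : L →ₗ[R] M, LinearMap.range f

variable {R}

/-- `M` is `W`-torsion free: every `w ∈ W` acts injectively. -/
def IsTorsionFreeFor (M : Type u) [AddCommGroup M] [Module R M] : Prop :=
  ∀ w ∈ W, Function.Injective fun z : M => w • z

/-- `M` is `W`-divisible: every `w ∈ W` acts surjectively. -/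
def IsDivisibleFor (M : Type u) [AddCommGroup M] [Module R M] : Prop :=
  ∀ w ∈ W, Function.Surjective fun z : M => w • z

/-- `M` is `h_W`-divisible: it is an `R`-linear quotient of a free `W⁻¹R`-module. -/
def IsHDivisibleFor (M : Type u) [AddCommGroup M] [Module R M] : Prop :=
  ∃ (N : Type u) (_ : AddCommGroup N) (_ : Module R N) (_ : Module (Localization W) N)
    (_ : IsScalarTower R (Localization W) N),
    Module.Free (Localization W) N ∧ ∃ f : N →ₗ[R] M, Function.Surjective f

/-- The `W`-torsion submodule: the kernel of the localization map `M → W⁻¹M`. -/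
def torsion (M : Type u) [AddCommGroup M] [Module R M] : Submodule R M :=
  LinearMap.ker (LocalizedModule.mkLinearMap W M)

/-- The sum of all `W`-divisible submodules of `M`. -/
def divisible (M : Type u) [AddCommGroup M] [Module R M] : Submodule R M :=
  sSup {L : Submodule R M | IsDivisibleFor W L}

theorem map_trace_le (L : Type u) [AddCommGroup L] [Module R L] {M N : Type u}
    [AddCommGroup M] [Module R M] [AddCommGroup N] [Module R N] (g : M →ₗ[R] N) :
    (trace R L M).map g ≤ trace R L N := by
  rw [trace, Submodule.map_iSup]
  refine iSup_le fun f => ?_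
  rw [← LinearMap.range_comp]
  exact le_iSup (fun f : L →ₗ[R] N => LinearMap.range f) (g ∘ₗ f)

theorem map_torsion_le {M N : Type u}
    [AddCommGroup M] [Module R M] [AddCommGroup N] [Module R N] (g : M →ₗ[R] N) :
    (torsion W M).map g ≤ torsion W N := by
  rintro _ ⟨z, hz, rfl⟩
  have hz' : LocalizedModule.mkLinearMap W M z = 0 := hz
  change LocalizedModule.mkLinearMap W N (g z) = 0
  rw [← IsLocalizedModule.map_apply W (LocalizedModule.mkLinearMap W M)
    (LocalizedModule.mkLinearMap W N) g z, hz', map_zero]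

theorem map_divisible_le {M N : Type u}
    [AddCommGroup M] [Module R M] [AddCommGroup N] [Module R N] (g : M →ₗ[R] N) :
    (divisible W M).map g ≤ divisible W N := by
  rw [Submodule.map_le_iff_le_comap]
  refine sSup_le fun L hL => ?_
  rw [← Submodule.map_le_iff_le_comap]
  refine le_sSup ?_
  rintro w hw ⟨_, x, hx, rfl⟩
  obtain ⟨y, hy⟩ := hL w hw ⟨x, hx⟩
  refine ⟨⟨g y, y, y.2, rfl⟩, Subtype.ext ?_⟩
  have hy' : w • (y : M) = x := congrArg Subtype.val hy
  change w • g y = g x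
  rw [← hy', map_smul]

theorem map_equiv_of_map_le {M N : Type u}
    [AddCommGroup M] [Module R M] [AddCommGroup N] [Module R N] (A : Submodule R M)
    (B : Submodule R N) (e : M ≃ₗ[R] N) (h₁ : A.map (e : M →ₗ[R] N) ≤ B)
    (h₂ : B.map (e.symm : N →ₗ[R] M) ≤ A) : A.map (e : M →ₗ[R] N) = B := by
  refine le_antisymm h₁ fun y hy => ?_
  exact ⟨e.symm y, h₂ ⟨y, hy, rfl⟩, e.apply_symm_apply y⟩

/-- The trace `tr_L` as a submodule selector on `P`. -/
def traceSelector (P : ModuleClass R) (L : Type u) [AddCommGroup L] [Module R L] :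
    SubmoduleSelector P where
  sel M _ _ _ := trace R L M
  map_equiv _ _ e := map_equiv_of_map_le _ _ e (map_trace_le L _) (map_trace_le L _)

/-- The `W`-torsion submodule selector on `P`. -/
def torsionSelector (P : ModuleClass R) : SubmoduleSelector P where
  sel M _ _ _ := torsion W M
  map_equiv _ _ e := map_equiv_of_map_le _ _ e (map_torsion_le W _) (map_torsion_le W _)

/-- The `W`-divisible submodule selector on `P`. -/
def divisibleSelector (P : ModuleClass R) : SubmoduleSelector P where
  sel M _ _ _ := divisible W M
  map_equiv _ _ e := map_equiv_of_map_le _ _ e (map_divisible_le W _) (map_divisible_le W _)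

/-- The set `W`, directed by divisibility in `R`. -/
structure DivIndex where
  val : R
  mem : val ∈ W

instance : Preorder (DivIndex W) where
  le v w := v.val ∣ w.val
  le_refl v := dvd_refl v.val
  le_trans _ _ _ h₁ h₂ := dvd_trans h₁ h₂

instance : Nonempty (DivIndex W) := ⟨⟨1, W.one_mem⟩⟩

instance : IsDirected (DivIndex W) (· ≤ ·) :=
  ⟨fun v w => ⟨⟨v.val * w.val, W.mul_mem v.mem w.mem⟩, Dvd.intro _ rfl, Dvd.intro_left _ rfl⟩⟩

end Rules

/-! ### Matlis duality and the smile dual -/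

section Duality

variable {R : Type u} [CommRing R]

/-- `ι : N → E` exhibits `E` as an injective hull of `N`: `E` is injective and `ι` is an injective
map whose image is essential in `E`. -/
structure IsInjectiveHull {N E : Type u} [AddCommGroup N] [Module R N] [AddCommGroup E]
    [Module R E] (ι : N →ₗ[R] E) : Prop where
  injective_module : Module.Injective R E
  injective : Function.Injective ι
  essential : ∀ L : Submodule R E, L ⊓ LinearMap.range ι = ⊥ → L = ⊥

variable (R) (E : Type u) [AddCommGroup E] [Module R E]

/-- The dual `M^∨ = Hom_R(M, E)`. -/
abbrev Dual (M : Type u) [AddCommGroup M] [Module R M] : Type u := M →ₗ[R] E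

/-- The evaluation map `M → M^∨∨`, `z ↦ (g ↦ g z)`. -/
def evalMap (M : Type u) [AddCommGroup M] [Module R M] : M →ₗ[R] Dual R E (Dual R E M) :=
  LinearMap.flip LinearMap.id

/-- `M` is Matlis-dualizable: `M^∨∨ ≅ M`. In particular this holds when the evaluation map
`M → M^∨∨` is bijective. -/
def IsDualizable (M : Type u) [AddCommGroup M] [Module R M] : Prop :=
  Nonempty (Dual R E (Dual R E M) ≃ₗ[R] M)

/-- The class `P^∨` of all modules isomorphic to `N^∨` for some `N` in `P`. -/
def dualClass {R : Type u} [CommRing R] (E : Type u) [AddCommGroup E] [Module R E]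
    (P : ModuleClass R) : ModuleClass R := fun M _ _ =>
  ∃ (N : Type u) (_ : AddCommGroup N) (_ : Module R N), P N ∧ Nonempty (M ≃ₗ[R] Dual R E N)

/-- For `A ⊆ M^∨`, the dual `(M^∨ / A)^∨`, embedded in `M^∨∨` by composition with
`M^∨ → M^∨ / A` and viewed as a submodule of `M` through the evaluation map `M → M^∨∨`. -/
def dualQuotient (M : Type u) [AddCommGroup M] [Module R M] (A : Submodule R (Dual R E M)) :
    Submodule R M :=
  (LinearMap.range (LinearMap.lcomp R E A.mkQ :
    Dual R E (Dual R E M ⧸ A) →ₗ[R] Dual R E (Dual R E M))).comap (evalMap R E M)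

variable {R}

theorem mem_dualQuotient {M : Type u} [AddCommGroup M] [Module R M] (A : Submodule R (Dual R E M))
    (z : M) : z ∈ dualQuotient R E M A ↔ ∀ g ∈ A, g z = 0 := by
  constructor
  · rintro ⟨φ, hφ⟩ g hg
    have h : φ (A.mkQ g) = g z := LinearMap.congr_fun hφ g
    rw [← h, Submodule.mkQ_apply, (Submodule.Quotient.mk_eq_zero A).2 hg, map_zero]
  · intro h
    exact ⟨A.liftQ (evalMap R E M z) fun g hg => h g hg, LinearMap.ext fun _ => rfl⟩

variable {E} in
theorem dual_mem_of_mem_dualClass {P : ModuleClass R} (hP : P.IsClosed)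
    (hD : ∀ (M : Type u) [AddCommGroup M] [Module R M], P M → IsDualizable R E M)
    {M : Type u} [AddCommGroup M] [Module R M] (hM : dualClass E P M) : P (Dual R E M) := by
  obtain ⟨N, _, _, hN, ⟨e⟩⟩ := hM
  obtain ⟨d⟩ := hD N hN
  exact hP.equiv (d.symm.trans (e.congrLeft E R).symm) hN

/-- The smile dual of a submodule selector `α` on a class `P` of Matlis-dualizable modules: the
submodule selector `M ↦ (M^∨ / α(M^∨))^∨ ⊆ M` on `P^∨`. -/
def SubmoduleSelector.smile {P : ModuleClass R} (hP : P.IsClosed)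
    (hD : ∀ (M : Type u) [AddCommGroup M] [Module R M], P M → IsDualizable R E M)
    (α : SubmoduleSelector P) : SubmoduleSelector (dualClass E P) where
  sel M _ _ hM := dualQuotient R E M (α.sel (Dual R E M) (dual_mem_of_mem_dualClass hP hD hM))
  map_equiv := by
    have key : ∀ {M N : Type u} [AddCommGroup M] [Module R M] [AddCommGroup N] [Module R N]
        (hM : dualClass E P M) (hN : dualClass E P N) (e : M ≃ₗ[R] N),
        (dualQuotient R E M (α.sel (Dual R E M) (dual_mem_of_mem_dualClass hP hD hM))).map
          (e : M →ₗ[R] N) ≤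
        dualQuotient R E N (α.sel (Dual R E N) (dual_mem_of_mem_dualClass hP hD hN)) := by
      rintro M N _ _ _ _ hM hN e _ ⟨z, hz, rfl⟩
      have hz' := (mem_dualQuotient E _ z).1 hz
      refine (mem_dualQuotient E _ _).2 fun g hg => ?_
      refine hz' (g ∘ₗ (e : M →ₗ[R] N)) ?_
      rw [← α.map_equiv (dual_mem_of_mem_dualClass hP hD hN)
        (dual_mem_of_mem_dualClass hP hD hM) (e.symm.congrLeft E R)]
      exact ⟨g, hg, rfl⟩
    intro M N _ _ _ _ hM hN e
    exact map_equiv_of_map_le _ _ e (key hM hN e) (key hN hM e.symm)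

end Duality

end Selectors

end

/-!
For a bilinear pairing of `M` with `N`, the elements of `⋂ w M` annihilate the `W`-torsion of `N`.
Conversely, if `E` is injective, a functional `g : N → E` vanishing on the torsion extends along
`N → W⁻¹N` to some `h`, so `g` is the value at `1` of `s ↦ h (s • ·)`, a map `W⁻¹R → N^∨`. Hence
`tr ⊆ dv ⊆ ⋂ w N^∨ ⊆ (tor N)^⊥ ⊆ tr` on every module `N^∨`, in particular on `M ≅ (M^∨)^∨`. If `E`
is moreover a cogenerator, then `tor N` is recovered as the common kernel of `(tor N)^⊥ = dv (N^∨)`.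
-/

namespace Selectors

section Trace

variable {R L M : Type u} [CommRing R] [AddCommGroup L] [Module R L] [AddCommGroup M] [Module R M]

theorem apply_mem_trace (f : L →ₗ[R] M) (x : L) : f x ∈ trace R L M :=
  Submodule.mem_iSup_of_mem f ⟨x, rfl⟩

theorem trace_le_iff {A : Submodule R M} : trace R L M ≤ A ↔ ∀ (f : L →ₗ[R] M) x, f x ∈ A :=
  iSup_le_iff.trans (forall_congr' fun _ => LinearMap.range_le_iff_comap.trans
    Submodule.eq_top_iff')

theorem trace_eq_top_iff_exists_finsupp_surjective :
    trace R L M = ⊤ ↔ ∃ (ι : Type u) (f : (ι →₀ L) →ₗ[R] M), Function.Surjective f := by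
  constructor
  · intro h
    refine ⟨L →ₗ[R] M, Finsupp.lsum R fun f => f, LinearMap.range_eq_top.1 ?_⟩
    rw [← top_le_iff, ← h, trace_le_iff]
    exact fun f x => ⟨Finsupp.single f x, by simp⟩
  · rintro ⟨ι, f, hf⟩
    refine Submodule.eq_top_iff'.2 fun z => ?_
    obtain ⟨y, rfl⟩ := hf z
    induction y using Finsupp.induction_linear with
    | zero => simp
    | add a b ha hb => simpa using add_mem ha hb
    | single i x => exact apply_mem_trace (f ∘ₗ Finsupp.lsingle i) x

theorem trace_quotient (I : Ideal R) : trace R (R ⧸ I) M = Submodule.torsionBySet R M I := by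
  refine le_antisymm (trace_le_iff.2 fun f x => ?_) fun z hz => ?_
  · refine (Submodule.mem_torsionBySet_iff _ _).2 fun r => ?_
    obtain ⟨a, rfl⟩ := Ideal.Quotient.mk_surjective x
    have hra : (r : R) • Ideal.Quotient.mk I a = 0 :=
      Ideal.Quotient.eq_zero_iff_mem.2 (I.mul_mem_right a r.2)
    rw [← map_smul, hra, map_zero]
  · have hI : I ≤ LinearMap.ker (LinearMap.toSpanSingleton R M z) := fun r hr =>
      (Submodule.mem_torsionBySet_iff _ _).1 hz ⟨r, hr⟩
    have liftQ_one : I.liftQ _ hI (Submodule.Quotient.mk 1) = z := one_smul R z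
    exact liftQ_one ▸ apply_mem_trace (I.liftQ _ hI) _

theorem trace_quotient_span_singleton (r : R) :
    trace R (R ⧸ Ideal.span {r}) M = Submodule.torsionBy R M r := by
  rw [trace_quotient, Submodule.torsionBySet_ideal_span_singleton_eq]

theorem trace_linearMap_eq_top (S : Type u) [Ring S] [Algebra R S] [Module S L]
    [IsScalarTower R S L] : trace R S (L →ₗ[R] M) = ⊤ := by
  refine Submodule.eq_top_iff'.2 fun g => ?_
  have eval_one : (Algebra.lsmul R R L).toLinearMap.compr₂ g (1 : S) = g := by
    ext x
    simp
  exact eval_one ▸ apply_mem_trace ((Algebra.lsmul R R L).toLinearMap.compr₂ g) (1 : S)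

end Trace

section Torsion

variable {R : Type u} [CommRing R] (W : Submonoid R) (M : Type u) [AddCommGroup M] [Module R M]

variable {M} in
theorem mem_torsion_iff {z : M} : z ∈ torsion W M ↔ ∃ w ∈ W, w • z = 0 :=
  LocalizedModule.mem_ker_mkLinearMap_iff

theorem torsion_eq_torsion' : torsion W M = Submodule.torsion' R M W :=
  Submodule.ext fun _ => (mem_torsion_iff W).trans (by simp [Submonoid.smul_def])

theorem isTorsionFreeFor_iff_torsion_eq_bot : IsTorsionFreeFor W M ↔ torsion W M = ⊥ := by
  have injective_smul_iff (w : R) :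
      Function.Injective (fun z : M => w • z) ↔ ∀ z : M, w • z = 0 → z = 0 :=
    injective_iff_map_eq_zero (LinearMap.lsmul R M w)
  simp only [IsTorsionFreeFor, injective_smul_iff, Submodule.eq_bot_iff, mem_torsion_iff]
  exact ⟨fun h z ⟨w, hw, hz⟩ => h w hw z hz, fun h w hw z hz => h z ⟨w, hw, hz⟩⟩

theorem torsion_torsion_eq_top : torsion W (torsion W M) = ⊤ := by
  rw [torsion_eq_torsion' W M, torsion_eq_torsion', Submodule.torsion'_torsion'_eq_top]

theorem torsion_quotient_torsion_eq_bot : torsion W (M ⧸ torsion W M) = ⊥ := by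
  refine (Submodule.eq_bot_iff _).2 fun z hz => ?_
  obtain ⟨x, rfl⟩ := Submodule.Quotient.mk_surjective _ z
  obtain ⟨w, hw, hwx⟩ := (mem_torsion_iff W).1 hz
  rw [← Submodule.Quotient.mk_smul, Submodule.Quotient.mk_eq_zero, mem_torsion_iff] at hwx
  obtain ⟨v, hv, hvwx⟩ := hwx
  rw [Submodule.Quotient.mk_eq_zero, mem_torsion_iff]
  exact ⟨v * w, W.mul_mem hv hw, by rw [mul_smul, hvwx]⟩

end Torsion

section Divisible

variable {R : Type u} [CommRing R] {W : Submonoid R} {M N : Type u} [AddCommGroup M] [Module R M]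
  [AddCommGroup N] [Module R N]

theorem IsDivisibleFor.of_surjective (hM : IsDivisibleFor W M) {f : M →ₗ[R] N}
    (hf : Function.Surjective f) : IsDivisibleFor W N := by
  intro w hw z
  obtain ⟨x, rfl⟩ := hf z
  obtain ⟨y, rfl⟩ := hM w hw x
  exact ⟨f y, (map_smul f w y).symm⟩

theorem isDivisibleFor_of_isLocalizedModule (f : M →ₗ[R] N) [IsLocalizedModule W f] :
    IsDivisibleFor W N := fun w hw =>
  ((Module.End.isUnit_iff _).1 (IsLocalizedModule.map_units f ⟨w, hw⟩)).surjective

theorem trace_le_divisible (hM : IsDivisibleFor W M) : trace R M N ≤ divisible W N :=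
  iSup_le fun f => le_sSup (hM.of_surjective f.surjective_rangeRestrict)

variable (W M)

theorem isDivisibleFor_divisible : IsDivisibleFor W (divisible W M) := by
  intro w hw
  have le_map_smul : divisible W M ≤ (divisible W M).map (LinearMap.lsmul R M w) := by
    refine sSup_le fun L hL x hx => ?_
    obtain ⟨y, hy⟩ := hL w hw ⟨x, hx⟩
    exact ⟨y, le_sSup (a := L) hL y.2, congrArg Subtype.val hy⟩
  rintro ⟨x, hx⟩
  obtain ⟨y, hy, hyx⟩ := le_map_smul hx
  exact ⟨⟨y, hy⟩, Subtype.ext hyx⟩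

theorem isDivisibleFor_iff_divisible_eq_top : IsDivisibleFor W M ↔ divisible W M = ⊤ := by
  constructor
  · exact fun h => top_le_iff.1 (le_sSup (h.of_surjective
      (f := Submodule.topEquiv.symm.toLinearMap) Submodule.topEquiv.symm.surjective))
  · intro h
    refine (isDivisibleFor_divisible W M).of_surjective (f := (divisible W M).subtype) ?_
    rw [← LinearMap.range_eq_top, Submodule.range_subtype, h]

theorem divisible_divisible_eq_top : divisible W (divisible W M) = ⊤ :=
  (isDivisibleFor_iff_divisible_eq_top W _).1 (isDivisibleFor_divisible W M)

theorem trace_localization_le_divisible : trace R (Localization W) M ≤ divisible W M :=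
  trace_le_divisible (isDivisibleFor_of_isLocalizedModule (Algebra.linearMap R (Localization W)))

theorem isHDivisibleFor_iff_trace_eq_top :
    IsHDivisibleFor W M ↔ trace R (Localization W) M = ⊤ := by
  rw [trace_eq_top_iff_exists_finsupp_surjective]
  constructor
  · rintro ⟨F, _, _, _, _, _, f, hf⟩
    let e := (Module.Free.chooseBasis (Localization W) F).repr.symm.restrictScalars R
    exact ⟨_, f ∘ₗ e.toLinearMap, hf.comp e.surjective⟩
  · rintro ⟨ι, f, hf⟩
    exact ⟨ι →₀ Localization W, inferInstance, inferInstance, inferInstance, inferInstance,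
      inferInstance, f, hf⟩

theorem divisible_le_iInf_range_lsmul :
    divisible W M ≤ ⨅ w : W, LinearMap.range (LinearMap.lsmul R M (w : R)) := by
  refine le_iInf fun w x hx => ?_
  obtain ⟨y, hy⟩ := isDivisibleFor_divisible W M w w.2 ⟨x, hx⟩
  exact ⟨y, congrArg Subtype.val hy⟩

end Divisible

section Selector

variable {R : Type u} [CommRing R] (W : Submonoid R) (P : ModuleClass R)

theorem monotone_traceSelector_quotient :
    Monotone fun w : DivIndex W => traceSelector P (R ⧸ Ideal.span {w.val}) := by
  intro v w hvw M _ _ _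
  change trace R (R ⧸ Ideal.span {v.val}) M ≤ trace R (R ⧸ Ideal.span {w.val}) M
  simp only [trace_quotient_span_singleton]
  exact Submodule.torsionBy_le_torsionBy_of_dvd _ _ hvw

theorem torsionSelector_eq_dirLim :
    torsionSelector W P = SubmoduleSelector.dirLim _ (monotone_traceSelector_quotient W P) := by
  ext M _ _ hM z
  change z ∈ torsion W M ↔ z ∈ ⋃ w : DivIndex W, (trace R (R ⧸ Ideal.span {w.val}) M : Set M)
  simp only [mem_torsion_iff, trace_quotient_span_singleton, Set.mem_iUnion, SetLike.mem_coe,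
    Submodule.mem_torsionBy_iff]
  exact ⟨fun ⟨w, hw, hz⟩ => ⟨⟨w, hw⟩, hz⟩, fun ⟨w, hz⟩ => ⟨w.val, w.mem, hz⟩⟩

variable {P}

theorem SubmoduleSelector.isIdempotent_of_sel_sel_eq_top (hP : P.IsClosed)
    {α : SubmoduleSelector P}
    (h : ∀ (M : Type u) [AddCommGroup M] [Module R M] (hM : P M),
      α.sel (α.sel M hM) (hP.submodule _ hM) = ⊤) : α.IsIdempotent hP := fun M _ _ hM => by
  rw [h, Submodule.map_subtype_top]

theorem isIdempotent_divisibleSelector (hP : P.IsClosed) :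
    (divisibleSelector W P).IsIdempotent hP :=
  SubmoduleSelector.isIdempotent_of_sel_sel_eq_top hP fun M _ _ _ => divisible_divisible_eq_top W M

theorem isIdempotent_torsionSelector (hP : P.IsClosed) : (torsionSelector W P).IsIdempotent hP :=
  SubmoduleSelector.isIdempotent_of_sel_sel_eq_top hP fun M _ _ _ => torsion_torsion_eq_top W M

end Selector

section Cogenerator

variable {R E : Type u} [CommRing R] [AddCommGroup E] [Module R E]

variable (R E) in
/-- `E` is a cogenerator: the functionals `M → E` separate the points of every module `M`. -/
def IsCogenerator : Prop :=
  ∀ (M : Type u) [AddCommGroup M] [Module R M] (z : M), (∀ g : Dual R E M, g z = 0) → z = 0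

theorem IsCogenerator.mem_iff_forall_le_ker (hE : IsCogenerator R E) {M : Type u}
    [AddCommGroup M] [Module R M] {L : Submodule R M} {z : M} :
    z ∈ L ↔ ∀ g : Dual R E M, L ≤ LinearMap.ker g → g z = 0 := by
  refine ⟨fun hz g hg => hg hz, fun h => ?_⟩
  rw [← Submodule.Quotient.mk_eq_zero L]
  exact hE _ _ fun g => h (g ∘ₗ L.mkQ) (L.ker_mkQ.ge.trans (LinearMap.ker_le_ker_comp _ g))

theorem exists_comp_eq_of_ker_le_ker [Module.Injective R E] {M N : Type*} [AddCommGroup M]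
    [Module R M] [AddCommGroup N] [Module R N] (f : M →ₗ[R] N) (g : M →ₗ[R] E)
    (h : LinearMap.ker f ≤ LinearMap.ker g) : ∃ g' : N →ₗ[R] E, g' ∘ₗ f = g := by
  have hf : Function.Injective ((LinearMap.ker f).liftQ f le_rfl) :=
    LinearMap.ker_eq_bot.1 (Submodule.ker_liftQ_eq_bot' _ _ rfl)
  obtain ⟨g', hg'⟩ := Module.Injective.extension_property R _ _ _ _ hf ((LinearMap.ker f).liftQ g h)
  exact ⟨g', LinearMap.ext fun x => LinearMap.congr_fun hg' (Submodule.Quotient.mk x)⟩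

theorem isCogenerator_of_forall_isMaximal [Module.Injective R E]
    (h : ∀ m : Ideal R, m.IsMaximal → ∃ f : (R ⧸ m) →ₗ[R] E, f ≠ 0) : IsCogenerator R E := by
  intro M _ _ z hz
  by_contra hz₀
  have annihilator_ne_top : LinearMap.ker (LinearMap.toSpanSingleton R M z) ≠ ⊤ := fun htop =>
    hz₀ (by simpa using htop.ge (Submodule.mem_top (x := (1 : R))))
  obtain ⟨m, hm, hle⟩ := Ideal.exists_le_maximal _ annihilator_ne_top
  obtain ⟨f, hf⟩ := h m hm
  obtain ⟨g, hg⟩ := exists_comp_eq_of_ker_le_ker (LinearMap.toSpanSingleton R M z) (f ∘ₗ m.mkQ)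
    (hle.trans (m.ker_mkQ.ge.trans (LinearMap.ker_le_ker_comp _ f)))
  have comp_eq_zero : f ∘ₗ m.mkQ = 0 := by
    rw [← hg]
    ext
    simpa using hz g
  exact hf (Submodule.linearMap_qext m comp_eq_zero)

theorem isCogenerator_of_residueField [IsLocalRing R] [Module.Injective R E]
    {ι : IsLocalRing.ResidueField R →ₗ[R] E} (hι : ι ≠ 0) : IsCogenerator R E := by
  refine isCogenerator_of_forall_isMaximal fun m hm => ?_
  obtain rfl := IsLocalRing.eq_maximalIdeal hm
  exact ⟨ι, hι⟩

end Cogenerator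

section Duality

variable {R E M N : Type u} [CommRing R] (W : Submonoid R) [AddCommGroup E] [Module R E]
  [AddCommGroup M] [Module R M] [AddCommGroup N] [Module R N]

theorem torsion_le_ker_of_mem_iInf_range_lsmul (B : M →ₗ[R] Dual R E N) {z : M}
    (hz : z ∈ ⨅ w : W, LinearMap.range (LinearMap.lsmul R M (w : R))) :
    torsion W N ≤ LinearMap.ker (B z) := by
  intro x hx
  obtain ⟨w, hw, hwx⟩ := (mem_torsion_iff W).1 hx
  obtain ⟨y, rfl⟩ := (Submodule.mem_iInf _).1 hz ⟨w, hw⟩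
  calc B (w • y) x = B y (w • x) := by simp
    _ = 0 := by rw [hwx, map_zero]

theorem mem_trace_localization_dual_of_torsion_le_ker [Module.Injective R E] {g : Dual R E N}
    (hg : torsion W N ≤ LinearMap.ker g) : g ∈ trace R (Localization W) (Dual R E N) := by
  obtain ⟨h, rfl⟩ := exists_comp_eq_of_ker_le_ker (LocalizedModule.mkLinearMap W N) g hg
  have hh : h ∈ trace R (Localization W) (Dual R E (LocalizedModule W N)) := by
    rw [trace_linearMap_eq_top]
    exact Submodule.mem_top
  exact map_trace_le _ (LinearMap.lcomp R E (LocalizedModule.mkLinearMap W N)) ⟨h, hh, rfl⟩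

theorem iInf_range_lsmul_le_trace_localization [Module.Injective R E] (e : Dual R E N ≃ₗ[R] M) :
    ⨅ w : W, LinearMap.range (LinearMap.lsmul R M (w : R)) ≤ trace R (Localization W) M := by
  intro z hz
  have hez := mem_trace_localization_dual_of_torsion_le_ker W
    (torsion_le_ker_of_mem_iInf_range_lsmul W e.symm.toLinearMap hz)
  exact map_trace_le _ e.toLinearMap ⟨_, hez, e.apply_symm_apply z⟩

theorem divisible_eq_trace_localization [Module.Injective R E] (e : Dual R E N ≃ₗ[R] M) :
    divisible W M = trace R (Localization W) M :=
  le_antisymm ((divisible_le_iInf_range_lsmul W M).trans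
    (iInf_range_lsmul_le_trace_localization W e)) (trace_localization_le_divisible W M)

theorem divisible_eq_iInf_range_lsmul [Module.Injective R E] (e : Dual R E N ≃ₗ[R] M) :
    divisible W M = ⨅ w : W, LinearMap.range (LinearMap.lsmul R M (w : R)) :=
  le_antisymm (divisible_le_iInf_range_lsmul W M)
    ((iInf_range_lsmul_le_trace_localization W e).trans (trace_localization_le_divisible W M))

theorem mem_divisible_dual_iff [Module.Injective R E] {g : Dual R E N} :
    g ∈ divisible W (Dual R E N) ↔ torsion W N ≤ LinearMap.ker g :=
  ⟨fun hg => torsion_le_ker_of_mem_iInf_range_lsmul W LinearMap.id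
      (divisible_le_iInf_range_lsmul W _ hg),
    fun hg => trace_localization_le_divisible W _
      (mem_trace_localization_dual_of_torsion_le_ker W hg)⟩

theorem torsion_eq_dualQuotient_divisible [Module.Injective R E] (hE : IsCogenerator R E) :
    torsion W N = dualQuotient R E N (divisible W (Dual R E N)) := by
  ext z
  simp only [mem_dualQuotient, mem_divisible_dual_iff]
  exact hE.mem_iff_forall_le_ker

theorem torsionSelector_eq_smile_divisibleSelector [Module.Injective R E]
    (hE : IsCogenerator R E) {P : ModuleClass R} (hP : P.IsClosed)
    (hD : ∀ (M : Type u) [AddCommGroup M] [Module R M], P M → IsDualizable R E M) :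
    torsionSelector W (dualClass E P) = (divisibleSelector W P).smile E hP hD := by
  ext M _ _ _ : 5
  exact torsion_eq_dualQuotient_divisible W hE

end Duality

end Selectors

open Selectors in
theorem proposition9p3_general {R : Type u} [CommRing R] (W : Submonoid R) :
    (∀ (M : Type u) [AddCommGroup M] [Module R M], IsTorsionFreeFor W M ↔ torsion W M = ⊥) ∧
    (∀ (M : Type u) [AddCommGroup M] [Module R M], IsDivisibleFor W M ↔ divisible W M = ⊤) ∧
    (∀ (M : Type u) [AddCommGroup M] [Module R M],
      IsHDivisibleFor W M ↔ trace R (Localization W) M = ⊤) ∧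
    (∀ (M : Type u) [AddCommGroup M] [Module R M],
      trace R (Localization W) M ≤ divisible W M) ∧
    (∀ (P : ModuleClass R) (hP : P.IsClosed),
      traceSelector P (Localization W) ≤ divisibleSelector W P ∧
      (∃ hs : Monotone fun w : DivIndex W => traceSelector P (R ⧸ Ideal.span {w.val}),
        torsionSelector W P = SubmoduleSelector.dirLim _ hs) ∧
      ((divisibleSelector W P).IsIdempotent hP ∧ (divisibleSelector W P).IsFunctorial) ∧
      ((torsionSelector W P).IsIdempotent hP ∧ (torsionSelector W P).IsFunctorial ∧
        (torsionSelector W P).IsCoidempotent hP)) ∧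
    (∀ (E : Type u) [AddCommGroup E] [Module R E] [Module.Injective R E]
      (M N : Type u) [AddCommGroup M] [Module R M] [AddCommGroup N] [Module R N],
      (Dual R E N ≃ₗ[R] M) →
      divisible W M = trace R (Localization W) M ∧
      divisible W M = ⨅ w : W, LinearMap.range (LinearMap.lsmul R M (w : R))) ∧
    (∀ (E : Type u) [AddCommGroup E] [Module R E] [Module.Injective R E], IsCogenerator R E →
      (∀ (P : ModuleClass R) (hP : P.IsClosed)
        (hD : ∀ (M : Type u) [AddCommGroup M] [Module R M], P M → IsDualizable R E M),
        torsionSelector W (dualClass E P) = (divisibleSelector W P).smile E hP hD) ∧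
      (∀ (M : Type u) [AddCommGroup M] [Module R M],
        torsion W M = dualQuotient R E M (divisible W (Dual R E M)))) := by
  refine ⟨isTorsionFreeFor_iff_torsion_eq_bot W, isDivisibleFor_iff_divisible_eq_top W,
    isHDivisibleFor_iff_trace_eq_top W, trace_localization_le_divisible W,
    fun P hP => ⟨?_, ⟨_, torsionSelector_eq_dirLim W P⟩,
      ⟨isIdempotent_divisibleSelector W hP, fun _ _ g => map_divisible_le W g⟩,
      isIdempotent_torsionSelector W hP, fun _ _ g => map_torsion_le W g, ?_⟩,
    fun E _ _ _ M N _ _ _ _ e => ?_, fun E _ _ _ hE => ⟨fun P hP hD => ?_, fun M _ _ => ?_⟩⟩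
  · exact fun M _ _ _ => trace_localization_le_divisible W M
  · exact fun M _ _ _ => torsion_quotient_torsion_eq_bot W M
  · exact ⟨divisible_eq_trace_localization W e, divisible_eq_iInf_range_lsmul W e⟩
  · exact torsionSelector_eq_smile_divisibleSelector W hE hP hD
  · exact torsion_eq_dualQuotient_divisible W hE

open Selectors in
theorem proposition9p3 {R : Type u} [CommRing R] (W : Submonoid R) :
    -- torsion freeness, divisibility and h-divisibility
    (∀ (M : Type u) [AddCommGroup M] [Module R M], IsTorsionFreeFor W M ↔ torsion W M = ⊥) ∧
    (∀ (M : Type u) [AddCommGroup M] [Module R M], IsDivisibleFor W M ↔ divisible W M = ⊤) ∧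
    (∀ (M : Type u) [AddCommGroup M] [Module R M],
      IsHDivisibleFor W M ↔ trace R (Localization W) M = ⊤) ∧
    -- the trace of the localization lies in the divisible part
    (∀ (M : Type u) [AddCommGroup M] [Module R M],
      trace R (Localization W) M ≤ divisible W M) ∧
    -- the same comparison, and the other properties of the selectors, on any class of modules
    -- closed under submodules and quotients
    (∀ (P : ModuleClass R) (hP : P.IsClosed),
      traceSelector P (Localization W) ≤ divisibleSelector W P ∧
      (∃ hs : Monotone fun w : DivIndex W => traceSelector P (R ⧸ Ideal.span {w.val}),
        torsionSelector W P = SubmoduleSelector.dirLim _ hs) ∧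
      ((divisibleSelector W P).IsIdempotent hP ∧ (divisibleSelector W P).IsFunctorial) ∧
      ((torsionSelector W P).IsIdempotent hP ∧ (torsionSelector W P).IsFunctorial ∧
        (torsionSelector W P).IsCoidempotent hP)) ∧
    -- complete Noetherian local rings
    (∀ [IsLocalRing R] [IsNoetherianRing R] [IsAdicComplete (IsLocalRing.maximalIdeal R) R]
      (E : Type u) [AddCommGroup E] [Module R E] (ι : IsLocalRing.ResidueField R →ₗ[R] E),
      IsInjectiveHull ι →
      (∀ (M : Type u) [AddCommGroup M] [Module R M], IsDualizable R E M →
        divisible W M = trace R (Localization W) M) ∧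
      (∀ (P : ModuleClass R) (hP : P.IsClosed)
        (hD : ∀ (M : Type u) [AddCommGroup M] [Module R M], P M → IsDualizable R E M),
        torsionSelector W (dualClass E P) = (divisibleSelector W P).smile E hP hD) ∧
      (∀ (M : Type u) [AddCommGroup M] [Module R M], IsDualizable R E M →
        torsion W M = dualQuotient R E M (divisible W (Dual R E M))) ∧
      (∀ (M : Type u) [AddCommGroup M] [Module R M], IsDualizable R E M →
        divisible W M = ⨅ w : W, LinearMap.range (LinearMap.lsmul R M (w : R)))) := by
  obtain ⟨torsionFree_iff, divisible_iff, hDivisible_iff, trace_le, selectors, dual, cogenerator⟩ :=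
    proposition9p3_general W
  refine ⟨torsionFree_iff, divisible_iff, hDivisible_iff, trace_le, selectors,
    fun E _ _ ι hι => ?_⟩
  have := hι.injective_module
  obtain ⟨smile_eq, torsion_eq⟩ := cogenerator E
    (isCogenerator_of_residueField (LinearMap.ne_zero_of_injective hι.injective))
  exact ⟨fun M _ _ ⟨e⟩ => (dual E M _ e).1, smile_eq, fun M _ _ _ => torsion_eq M,
    fun M _ _ ⟨e⟩ => (dual E M _ e).2⟩
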